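/- Let $\Omega\subset\mathbb{R}^3$ be a bounded open set whose boundary $\Gamma=\partial\Omega$ is a $C^2$ surface. Let $d_\Gamma$ be the signed distance function to $\Gamma$, that is, $d_\Gamma(\mathbf{x})=\min_{\mathbf{y}\in\Gamma}\|\mathbf{x}-\mathbf{y}\|$ for $\mathbf{x}\in\Omega$ and $d_\Gamma(\mathbf{x})=-\min_{\mathbf{y}\in\Gamma}\|\mathbf{x}-\mathbf{y}\|$ for $\mathbf{x}\notin\Omega$. Let $\varepsilon>0$ be such that $d_\Gamma$ is twice continuously differentiable in the tubular neighborhood $T_\varepsilon=\{\mathbf{x}\in\mathbb{R}^3: |d_\Gamma(\mathbf{x})|<\varepsilon\}$. For $\eta\in[-\varepsilon,\varepsilon]$ let $\Gamma_\eta=\{\mathbf{x}\in T_\varepsilon: d_\Gamma(\mathbf{x})=\eta\}$ be the parallel surface at level $\eta$. Let $\mathbf{z}\in\Gamma_\eta$, and let $\bar{\mathbf{z}}=P_\Gamma\mathbf{z}$ be a point of $\Gamma$ closest to $\mathbf{z}$. The principal directions of a surface at a point are the unit tangent vectors along which the normal curvature (the signed curvature of the normal section, with respect to a unit normal of the surface)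 attains its minimum or its maximum over all unit tangent vectors; these extremal values are the principal curvatures. Then the principal directions of $\Gamma_\eta$ at $\mathbf{z}$ coincide with the principal directions of $\Gamma$ at $\bar{\mathbf{z}}$. More precisely, $\Gamma_\eta$ at $\mathbf{z}$ and $\Gamma$ at $\bar{\mathbf{z}}$ have the same unit normals, and, for either choice of the common unit normal $\mathbf{n}$, the directions of minimal normal curvature of $\Gamma_\eta$ at $\mathbf{z}$ are those of $\Gamma$ at $\bar{\mathbf{z}}$, and likewise the directions of maximal normal curvature. -/

import Mathlib

open Set Topology Metric

/-- Euclidean three-space. -/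
abbrev E3 : Type := EuclideanSpace ℝ (Fin 3)

/-- `S ⊆ ℝ³` is an (embedded) `C²` surface: near each of its points it is the zero set of a `C²`
function with nonvanishing differential. -/
def IsC2Surface (S : Set E3) : Prop :=
  ∀ p ∈ S, ∃ U : Set E3, IsOpen U ∧ p ∈ U ∧ ∃ φ : E3 → ℝ,
    ContDiffOn ℝ 2 φ U ∧ (∀ x ∈ U, fderiv ℝ φ x ≠ 0) ∧ S ∩ U = {x ∈ U | φ x = 0}

open Classical in
/-- The signed distance function to `Γ = ∂Ω`: positive in `Ω`, nonpositive outside `Ω`. -/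
noncomputable def signedDistance (Ω : Set E3) (x : E3) : ℝ :=
  if x ∈ Ω then infDist x (frontier Ω) else -infDist x (frontier Ω)

/-- The tubular neighborhood `T_ε = {|d_Γ| < ε}` of `Γ = ∂Ω`. -/
def tube (Ω : Set E3) (ε : ℝ) : Set E3 :=
  {x | |signedDistance Ω x| < ε}

/-- The parallel surface `Γ_η = {x ∈ T_ε | d_Γ(x) = η}` of `Γ = ∂Ω`. -/
def parallelSurface (Ω : Set E3) (ε η : ℝ) : Set E3 :=
  {x ∈ tube Ω ε | signedDistance Ω x = η}

/-- `q` is a closest point of `S` to `x`, that is, an admissible value of the closest point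
projection of `S` at `x`. -/
def IsClosestPoint (S : Set E3) (x q : E3) : Prop :=
  q ∈ S ∧ ∀ y ∈ S, ‖x - q‖ ≤ ‖x - y‖

/-- The tangent vectors of `S` at `p`: the velocities at `p` of `C¹` curves in `S`. -/
def tangentVectors (S : Set E3) (p : E3) : Set E3 :=
  {v | ∃ γ : ℝ → E3, ContDiffAt ℝ 1 γ 0 ∧ (∀ᶠ t in 𝓝 (0 : ℝ), γ t ∈ S) ∧
    γ 0 = p ∧ deriv γ 0 = v}

/-- The unit normals of `S` at `p` (two opposite vectors, if `S` is a surface). -/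
def unitNormals (S : Set E3) (p : E3) : Set E3 :=
  {N | ‖N‖ = 1 ∧ ∀ v ∈ tangentVectors S p, inner ℝ v N = 0}

/-- `S` has normal curvature `k` at `p` along the unit tangent vector `v`, with respect to the unit
normal `N`: the normal section of `S` along `v`, that is, the intersection of `S` with the plane
through `p` spanned by `v` and `N`, contains a `C²` curve `γ` with `γ(0) = p` and `γ'(0) = v`, whose
signed curvature at `p` is `k`. As `v` is a unit vector orthogonal to `N`, that signed curvature is
`⟨γ''(0), N⟩`. -/
def HasNormalCurvature (S : Set E3) (p N v : E3) (k : ℝ) : Prop :=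
  ‖v‖ = 1 ∧ ∃ γ : ℝ → E3, ContDiffAt ℝ 2 γ 0 ∧
    (∀ᶠ t in 𝓝 (0 : ℝ), γ t ∈ S ∧ γ t - p ∈ Submodule.span ℝ {v, N}) ∧
    γ 0 = p ∧ deriv γ 0 = v ∧ inner ℝ (deriv (deriv γ) 0) N = k

/-- The unit tangent vectors of `S` at `p` along which the normal curvature with respect to the
unit normal `N` attains its minimum, the first principal curvature. -/
def minPrincipalDirections (S : Set E3) (p N : E3) : Set E3 :=
  {v | ∃ k, HasNormalCurvature S p N v k ∧ ∀ w l, HasNormalCurvature S p N w l → k ≤ l}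

/-- The unit tangent vectors of `S` at `p` along which the normal curvature with respect to the
unit normal `N` attains its maximum, the second principal curvature. -/
def maxPrincipalDirections (S : Set E3) (p N : E3) : Set E3 :=
  {v | ∃ k, HasNormalCurvature S p N v k ∧ ∀ w l, HasNormalCurvature S p N w l → l ≤ k}

/-- The principal directions of `S` at `p`: the unit tangent vectors along which the normal
curvature attains its minimum or its maximum. Replacing `N` by `-N` exchanges the two, so that the
set does not depend on the choice of the normal. -/
def principalDirections (S : Set E3) (p : E3) : Set E3 :=
  {v | ∃ N ∈ unitNormals S p, v ∈ minPrincipalDirections S p N ∪ maxPrincipalDirections S p N}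

/-! Write `d` for the signed distance. Both surfaces are locally level sets of `d`, and `‖∇d‖ = 1`
in the tube. For the normal `σ∇d`, `σ = ±1`, the normal curvatures are therefore the values of `-σ
D²d` on unit vectors orthogonal to `∇d` (`hasNormalCurvature_iff_of_level`). It remains to compare
the Hessians `A` at `z` and `A₀` at the closest point `zbar`.

Let `c = d(z) ≠ 0`; the level `0` is trivial. The gradient is constant on the segment from `zbar` to
`z`, which gives equal normals and, near `z`, the identity `∇d(y - d(y)∇d(y)) = ∇d(y)`. Its
derivative is `A = A₀ - c A A₀`, up to transposition (`fderiv_gradient_signedDistance_eq`). So an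
eigenvector of `A₀` for `κ` is one of `A` for `κ / (1 + cκ)`, where `1 + cκ > 0`
(`hessian_signedDistance_eigenvector`). As `κ ↦ κ / (1 + cκ)` is increasing, both quadratic forms
have the same extremizers (`extremizes_iff_of_eigenvectors_orthogonal`). -/

/-! ### Extremizers of quadratic forms. -/

section QuadraticForms

variable {W : Type*} [NormedAddCommGroup W] [InnerProductSpace ℝ W]

/-- A unit vector maximizes the quadratic form of a diagonalized operator if and only if its
nonzero coordinates belong to maximal eigenvalues. -/
theorem maximizes_iff_of_diagonal {ι : Type*} [Fintype ι] (b : OrthonormalBasis ι ℝ W)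
    (T : W →ₗ[ℝ] W) (μ : ι → ℝ) (hT : ∀ i, T (b i) = μ i • b i) {v : W} (hv : ‖v‖ = 1) :
    (∀ w, ‖w‖ = 1 → inner ℝ (T w) w ≤ inner ℝ (T v) v) ↔
      ∀ i j, inner ℝ (b i) v ≠ 0 → μ j ≤ μ i := by
  have hform : ∀ w : W, inner ℝ (T w) w = ∑ i, μ i * inner ℝ (b i) w ^ 2 := by
    intro w
    have h1 : T w = ∑ i, inner ℝ (b i) w • μ i • b i := by
      conv_lhs => rw [← b.sum_repr' w]
      simp only [map_sum, map_smul, hT]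
    rw [h1, sum_inner]
    refine Finset.sum_congr rfl fun i _ => ?_
    simp only [inner_smul_left, RCLike.conj_to_real]
    ring
  have hone : ∀ w : W, ‖w‖ = 1 → ∑ i, inner ℝ (b i) w ^ 2 = 1 := by
    intro w hw
    have h1 := b.sum_sq_norm_inner_right w
    simpa [hw] using h1
  obtain ⟨i₀, hi₀⟩ : ∃ i, inner ℝ (b i) v ≠ 0 := by
    by_contra! h
    have h1 := hone v hv
    simp [h] at h1
  constructor
  · intro h i j hi
    -- Testing against an eigenvector of the largest eigenvalue makes a sum of nonnegative terms
    -- nonpositive, so each term vanishes.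
    obtain ⟨m, -, hm⟩ := Finset.exists_max_image Finset.univ μ ⟨i, Finset.mem_univ i⟩
    have h1 := h (b m) (b.orthonormal.1 m)
    rw [hT, inner_smul_left, real_inner_self_eq_norm_sq, b.orthonormal.1 m, hform v] at h1
    have h2 : ∑ k, (μ m - μ k) * inner ℝ (b k) v ^ 2 ≤ 0 := by
      simp only [sub_mul, Finset.sum_sub_distrib, ← Finset.mul_sum, hone v hv]
      simpa using h1
    have h3 : ∀ k ∈ Finset.univ, 0 ≤ (μ m - μ k) * inner ℝ (b k) v ^ 2 := fun k hk =>
      mul_nonneg (sub_nonneg.2 (hm k hk)) (sq_nonneg _)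
    have h4 := (Finset.sum_eq_zero_iff_of_nonneg h3).1
      (le_antisymm h2 (Finset.sum_nonneg h3)) i (Finset.mem_univ i)
    have h5 : μ m - μ i = 0 := (mul_eq_zero.1 h4).resolve_right (pow_ne_zero 2 hi)
    linarith [hm j (Finset.mem_univ j)]
  · intro h w hw
    have h1 : inner ℝ (T v) v = μ i₀ := by
      rw [hform v, ← mul_one (μ i₀), ← hone v hv, Finset.mul_sum]
      refine Finset.sum_congr rfl fun i _ => ?_
      by_cases hi : inner ℝ (b i) v = 0
      · simp [hi]
      · rw [le_antisymm (h i₀ i hi₀) (h i i₀ hi)]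
    rw [h1, hform w, ← mul_one (μ i₀), ← hone w hw, Finset.mul_sum]
    exact Finset.sum_le_sum fun i _ => mul_le_mul_of_nonneg_right (h i₀ i hi₀) (sq_nonneg _)

/-- The terms `c * x * y` cancel after cross-multiplication, so the sign of `c` is irrelevant. -/
theorem div_one_add_mul_le_iff {c x y : ℝ} (hx : 0 < 1 + c * x) (hy : 0 < 1 + c * y) :
    x / (1 + c * x) ≤ y / (1 + c * y) ↔ x ≤ y := by
  rw [div_le_div_iff₀ hx hy]
  constructor <;> intro h <;> linarith

variable [FiniteDimensional ℝ W]

/-- If `S = T (1 + c T)⁻¹` with `1 + c T` positive definite, then the quadratic forms of `S` and `T`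
have the same unit maximizers and the same unit minimizers. -/
theorem extremizes_iff_of_eigenvectors {T S : W →ₗ[ℝ] W} (hT : T.IsSymmetric) (c : ℝ)
    (hS : ∀ (e : W) (κ : ℝ), e ≠ 0 → T e = κ • e → 0 < 1 + c * κ ∧ (1 + c * κ) • S e = κ • e)
    {v : W} (hv : ‖v‖ = 1) :
    ((∀ w, ‖w‖ = 1 → inner ℝ (S w) w ≤ inner ℝ (S v) v) ↔
      ∀ w, ‖w‖ = 1 → inner ℝ (T w) w ≤ inner ℝ (T v) v) ∧
    ((∀ w, ‖w‖ = 1 → inner ℝ (S v) v ≤ inner ℝ (S w) w) ↔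
      ∀ w, ‖w‖ = 1 → inner ℝ (T v) v ≤ inner ℝ (T w) w) := by
  set b := hT.eigenvectorBasis rfl
  set μ := hT.eigenvalues rfl
  have hb : ∀ i, T (b i) = μ i • b i := fun i => by
    exact hT.apply_eigenvectorBasis rfl i
  have hpos : ∀ i, 0 < 1 + c * μ i := fun i => (hS _ _ (b.orthonormal.ne_zero i) (hb i)).1
  have hSb : ∀ i, S (b i) = (μ i / (1 + c * μ i)) • b i := fun i => by
    rw [div_eq_inv_mul, mul_smul, ← (hS _ _ (b.orthonormal.ne_zero i) (hb i)).2,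
      inv_smul_smul₀ (hpos i).ne']
  constructor
  · rw [maximizes_iff_of_diagonal b S _ hSb hv, maximizes_iff_of_diagonal b T _ hb hv]
    simp only [div_one_add_mul_le_iff (hpos _) (hpos _)]
  -- Minimizers are the maximizers for the negated operators.
  · have h1 := maximizes_iff_of_diagonal b (-S) (fun i => -(μ i / (1 + c * μ i)))
      (fun i => by simp [hSb i]) hv
    have h2 := maximizes_iff_of_diagonal b (-T) (fun i => -μ i) (fun i => by simp [hb i]) hv
    simp only [LinearMap.neg_apply, inner_neg_left, neg_le_neg_iff] at h1 h2
    rw [h1, h2]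
    simp only [div_one_add_mul_le_iff (hpos _) (hpos _)]

/-- The version of `extremizes_iff_of_eigenvectors` on the orthogonal complement of a common
kernel vector. -/
theorem extremizes_iff_of_eigenvectors_orthogonal {A B : W →L[ℝ] W}
    (hA : ∀ v w, inner ℝ (A v) w = inner ℝ v (A w)) (hB : ∀ v w, inner ℝ (B v) w = inner ℝ v (B w))
    {n : W} (hAn : A n = 0) (hBn : B n = 0) (c : ℝ)
    (hAB : ∀ (e : W) (κ : ℝ), e ≠ 0 → A e = κ • e → 0 < 1 + c * κ ∧ (1 + c * κ) • B e = κ • e)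
    {v : W} (hv : ‖v‖ = 1) (hvn : inner ℝ v n = 0) :
    ((∀ w, ‖w‖ = 1 → inner ℝ w n = 0 → inner ℝ (B w) w ≤ inner ℝ (B v) v) ↔
      ∀ w, ‖w‖ = 1 → inner ℝ w n = 0 → inner ℝ (A w) w ≤ inner ℝ (A v) v) ∧
    ((∀ w, ‖w‖ = 1 → inner ℝ w n = 0 → inner ℝ (B v) v ≤ inner ℝ (B w) w) ↔
      ∀ w, ‖w‖ = 1 → inner ℝ w n = 0 → inner ℝ (A v) v ≤ inner ℝ (A w) w) := by
  set V : Submodule ℝ W := (ℝ ∙ n)ᗮ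
  have hmem : ∀ w, w ∈ V ↔ inner ℝ w n = 0 := fun w =>
    Submodule.mem_orthogonal_singleton_iff_inner_left
  have hAV : ∀ w ∈ V, (A : W →ₗ[ℝ] W) w ∈ V := fun w _ => by
    rw [hmem]; simp [hA, hAn]
  have hBV : ∀ w ∈ V, (B : W →ₗ[ℝ] W) w ∈ V := fun w _ => by
    rw [hmem]; simp [hB, hBn]
  have hsym : (A : W →ₗ[ℝ] W).IsSymmetric := fun v w => hA v w
  have h := extremizes_iff_of_eigenvectors (hsym.restrict_invariant hAV)
    (S := (B : W →ₗ[ℝ] W).restrict hBV) c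
    (fun e κ he h => by
      have h1 := hAB e κ (by simpa using he) (by simpa using congrArg Subtype.val h)
      exact ⟨h1.1, Subtype.ext (by simpa using h1.2)⟩)
    (v := ⟨v, (hmem v).2 hvn⟩) (by simpa using hv)
  simpa [hmem, Subtype.forall, Submodule.coe_inner, forall_comm (α := _ = (0 : ℝ))] using h

end QuadraticForms

/-! ### Hessians and curves on level sets. -/

section LevelSets

variable {E : Type*} [NormedAddCommGroup E] [InnerProductSpace ℝ E] [CompleteSpace E]
  {f : E → ℝ} {p : E}

theorem inner_gradient_eq_fderiv (f : E → ℝ) (p v : E) :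
    inner ℝ (gradient f p) v = fderiv ℝ f p v := by
  simp [gradient]

theorem contDiffAt_gradient (hf : ContDiffAt ℝ 2 f p) : ContDiffAt ℝ 1 (gradient f) p := by
  have h : ContDiffAt ℝ 1 (fderiv ℝ f) p := hf.fderiv_right (by norm_num)
  exact (InnerProductSpace.toDual ℝ E).symm.toContinuousLinearEquiv.contDiff.contDiffAt.comp p h

/-- Differentiate `⟨∇f, w⟩ = Df w`. This transfers the symmetry of second derivatives to the
derivative of the gradient. -/
theorem inner_fderiv_gradient (hf : ContDiffAt ℝ 2 f p) (v w : E) :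
    inner ℝ (fderiv ℝ (gradient f) p v) w = fderiv ℝ (fderiv ℝ f) p v w := by
  have h1 : DifferentiableAt ℝ (gradient f) p :=
    (contDiffAt_gradient hf).differentiableAt (by norm_num)
  have h2 : DifferentiableAt ℝ (fderiv ℝ f) p :=
    (hf.fderiv_right (m := 1) (by norm_num)).differentiableAt (by norm_num)
  have h3 : HasFDerivAt (fun x => inner ℝ (gradient f x) w) _ p :=
    h1.hasFDerivAt.inner ℝ (hasFDerivAt_const w p)
  have h4 : HasFDerivAt (fun x => fderiv ℝ f x w) _ p :=
    h2.hasFDerivAt.clm_apply (hasFDerivAt_const w p)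
  simp only [inner_gradient_eq_fderiv] at h3
  simpa using congrArg (fun L => L v) (h3.unique h4)

theorem fderiv_gradient_symm (hf : ContDiffAt ℝ 2 f p) (v w : E) :
    inner ℝ (fderiv ℝ (gradient f) p v) w = inner ℝ v (fderiv ℝ (gradient f) p w) := by
  rw [real_inner_comm _ v, inner_fderiv_gradient hf, inner_fderiv_gradient hf]
  exact hf.isSymmSndFDerivAt (by simp) v w

/-- If the gradient has constant norm, it is a null vector of the Hessian. -/
theorem fderiv_gradient_gradient_eq_zero (hf : ContDiffAt ℝ 2 f p)
    (h : ∀ᶠ x in 𝓝 p, ‖gradient f x‖ = 1) : fderiv ℝ (gradient f) p (gradient f p) = 0 := by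
  have h1 : DifferentiableAt ℝ (gradient f) p :=
    (contDiffAt_gradient hf).differentiableAt (by norm_num)
  have h2 := h1.hasFDerivAt.inner ℝ h1.hasFDerivAt
  have h3 : HasFDerivAt (fun x => inner ℝ (gradient f x) (gradient f x)) (0 : E →L[ℝ] ℝ) p :=
    (hasFDerivAt_const (1 : ℝ) p).congr_of_eventuallyEq
      (h.mono fun x hx => by simp [hx])
  set H := fderiv ℝ (gradient f) p with hH
  -- Differentiating `⟨∇f, ∇f⟩ = 1` in the direction `H ∇f` gives `⟨∇f, H H ∇f⟩ = 0`, which by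
  -- symmetry is `‖H ∇f‖² = 0`.
  have h4 := congrArg (fun L => L (H (gradient f p))) (h2.unique h3)
  simp only [ContinuousLinearMap.comp_apply, ContinuousLinearMap.prod_apply,
    fderivInnerCLM_apply, zero_apply] at h4
  rw [real_inner_comm (gradient f p), ← two_mul] at h4
  have h5 := fderiv_gradient_symm hf (H (gradient f p)) (gradient f p)
  rw [← hH] at h5
  rw [← inner_self_eq_zero (𝕜 := ℝ), ← h5, real_inner_comm]
  linarith

theorem inner_gradient_deriv_of_level (hf : DifferentiableAt ℝ f p) {γ : ℝ → E} {t c : ℝ}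
    (hγ : DifferentiableAt ℝ γ t) (hp : γ t = p) (h : ∀ᶠ s in 𝓝 t, f (γ s) = c) :
    inner ℝ (gradient f p) (deriv γ t) = 0 := by
  subst hp
  rw [inner_gradient_eq_fderiv]
  have h1 : HasDerivAt (f ∘ γ) (fderiv ℝ f (γ t) (deriv γ t)) t :=
    hf.hasFDerivAt.comp_hasDerivAt t hγ.hasDerivAt
  exact h1.unique ((hasDerivAt_const t c).congr_of_eventuallyEq h)

/-- The acceleration of a curve in a level set has a normal component that is determined by its
velocity. -/
theorem inner_deriv_deriv_gradient_of_level (hf : ContDiffAt ℝ 2 f p) {γ : ℝ → E} {c : ℝ}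
    (hγ : ContDiffAt ℝ 2 γ 0) (hp : γ 0 = p) (h : ∀ᶠ s in 𝓝 0, f (γ s) = c) :
    inner ℝ (deriv (deriv γ) 0) (gradient f p) =
      -inner ℝ (fderiv ℝ (gradient f) p (deriv γ 0)) (deriv γ 0) := by
  subst hp
  have hg : DifferentiableAt ℝ (gradient f) (γ 0) :=
    (contDiffAt_gradient hf).differentiableAt (by norm_num)
  have hγ1 : DifferentiableAt ℝ γ 0 := hγ.differentiableAt (by norm_num)
  have hγ2 : DifferentiableAt ℝ (deriv γ) 0 := by
    have h1 : ContDiffAt ℝ 1 (fderiv ℝ γ) 0 := hγ.fderiv_right (by norm_num)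
    exact (h1.clm_apply contDiffAt_const).differentiableAt (by norm_num)
  -- Orthogonality is needed for all `s` near `0`, since it is differentiated next.
  have h1 : ∀ᶠ s in 𝓝 (0 : ℝ), inner ℝ (gradient f (γ s)) (deriv γ s) = 0 := by
    filter_upwards [hγ1.continuousAt.eventually (hf.eventually (by simp)),
      hγ.eventually (by simp), h.eventually_nhds] with s hs1 hs2 hs3
    exact inner_gradient_deriv_of_level (hs1.differentiableAt (by norm_num))
      (hs2.differentiableAt (by norm_num)) rfl hs3
  have h2 := (hg.hasFDerivAt.comp_hasDerivAt (0 : ℝ) hγ1.hasDerivAt).inner ℝ hγ2.hasDerivAt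
  have h3 := h2.unique ((hasDerivAt_const (0 : ℝ) (0 : ℝ)).congr_of_eventuallyEq h1)
  rw [real_inner_comm]
  simp only [Function.comp_apply] at h3
  linarith

/-- The normal section of a regular level set contains a `C²` curve with any prescribed tangent
velocity. -/
theorem exists_curve_in_normal_section (hf : ContDiffAt ℝ 2 f p) {n v : E}
    (hn : fderiv ℝ f p n ≠ 0) (hv : fderiv ℝ f p v = 0) :
    ∃ γ : ℝ → E, ContDiffAt ℝ 2 γ 0 ∧ γ 0 = p ∧ deriv γ 0 = v ∧ (∀ᶠ t in 𝓝 0, f (γ t) = f p) ∧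
      ∀ t, γ t - p ∈ Submodule.span ℝ {v, n} := by
  -- The curve is sought as `p + t v + ψ(t) n`; the implicit function theorem yields `ψ`, because
  -- the partial derivative of `F` in the second variable is `Df(p) n ≠ 0`.
  set F : ℝ × ℝ → ℝ := fun u => f (p + u.1 • v + u.2 • n) with hF
  have hfp : ContDiffAt ℝ 2 f (p + (0 : ℝ × ℝ).1 • v + (0 : ℝ × ℝ).2 • n) := by simpa using hf
  have hFc : ContDiffAt ℝ 2 F (0, 0) :=
    hfp.comp (0 : ℝ × ℝ) (f := fun u : ℝ × ℝ => p + u.1 • v + u.2 • n) (by fun_prop)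
  have hinner : HasFDerivAt (fun u : ℝ × ℝ => p + u.1 • v + u.2 • n)
      ((ContinuousLinearMap.fst ℝ ℝ ℝ).smulRight v + (ContinuousLinearMap.snd ℝ ℝ ℝ).smulRight n)
      (0, 0) := by
    have h1 : HasFDerivAt (fun u : ℝ × ℝ => u.1 • v)
        ((ContinuousLinearMap.fst ℝ ℝ ℝ).smulRight v) (0, 0) :=
      ((ContinuousLinearMap.fst ℝ ℝ ℝ).smulRight v).hasFDerivAt
    have h2 : HasFDerivAt (fun u : ℝ × ℝ => u.2 • n)
        ((ContinuousLinearMap.snd ℝ ℝ ℝ).smulRight n) (0, 0) :=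
      ((ContinuousLinearMap.snd ℝ ℝ ℝ).smulRight n).hasFDerivAt
    exact (h1.const_add p).add h2
  have hF' : HasFDerivAt F ((fderiv ℝ f p).comp
      ((ContinuousLinearMap.fst ℝ ℝ ℝ).smulRight v + (ContinuousLinearMap.snd ℝ ℝ ℝ).smulRight n))
      (0, 0) := by
    refine HasFDerivAt.comp (0, 0) ?_ hinner
    simpa using (hf.differentiableAt (by norm_num)).hasFDerivAt
  have hinv : (fderiv ℝ F (0, 0) ∘L .inr ℝ ℝ ℝ).IsInvertible := by
    refine ⟨ContinuousLinearEquiv.unitsEquivAut ℝ (Units.mk0 _ hn), ?_⟩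
    ext
    simp [hF'.fderiv]
  set ψ := hFc.implicitFunction (by norm_num) hinv
  have hψ0 : ψ 0 = 0 := hFc.implicitFunction_apply_self (by norm_num) hinv
  have hψc : ContDiffAt ℝ 2 ψ 0 := hFc.contDiffAt_implicitFunction (by norm_num) hinv
  have hψF : ∀ᶠ x in 𝓝 (0 : ℝ), F (x, ψ x) = F (0, 0) :=
    hFc.eventually_apply_implicitFunction (by norm_num) hinv
  have hψ1 : HasDerivAt ψ (deriv ψ 0) 0 := (hψc.differentiableAt (by norm_num)).hasDerivAt
  have hγ' : HasDerivAt (fun t : ℝ => p + t • v + ψ t • n) (v + deriv ψ 0 • n) 0 := by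
    have h1 := (hasDerivAt_id (0 : ℝ)).smul_const v
    have h2 := hψ1.smul_const n
    simpa only [one_smul, id_eq] using (h1.const_add p).fun_add h2
  have hlevel : ∀ᶠ t in 𝓝 (0 : ℝ), f (p + t • v + ψ t • n) = f p := by
    simpa [hF] using hψF
  have hψ' : deriv ψ 0 = 0 := by
    have h1 := inner_gradient_deriv_of_level (hf.differentiableAt (by norm_num))
      hγ'.differentiableAt (by simp [hψ0]) hlevel
    rw [hγ'.deriv, inner_gradient_eq_fderiv, map_add, hv, zero_add, map_smul, smul_eq_mul] at h1
    exact (mul_eq_zero.1 h1).resolve_right hn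
  refine ⟨fun t => p + t • v + ψ t • n, by fun_prop, by simp [hψ0], ?_, hlevel, fun t => ?_⟩
  · simpa [hψ'] using hγ'.deriv
  · exact Submodule.mem_span_pair.2 ⟨t, ψ t, by module⟩

end LevelSets

/-! ### Normal curvature of level sets with unit gradient. -/

section NormalCurvature

variable {S : Set E3} {f : E3 → ℝ} {p : E3}

theorem tangentVectors_of_level (hf : ContDiffAt ℝ 2 f p) (hn : ‖gradient f p‖ = 1)
    (hS : ∀ᶠ x in 𝓝 p, x ∈ S ↔ f x = f p) :
    tangentVectors S p = {v | inner ℝ v (gradient f p) = 0} := by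
  ext v
  constructor
  · rintro ⟨γ, hγ, hγS, hγ0, rfl⟩
    have h1 : DifferentiableAt ℝ γ 0 := hγ.differentiableAt (by norm_num)
    rw [mem_ofPred_eq, real_inner_comm]
    refine inner_gradient_deriv_of_level (c := f p) (hf.differentiableAt (by norm_num)) h1 hγ0 ?_
    subst hγ0
    filter_upwards [hγS, h1.continuousAt.eventually hS] with t ht1 ht2 using ht2.1 ht1
  · intro hv
    obtain ⟨γ, hγ, hγ0, hγ1, hγf, -⟩ := exists_curve_in_normal_section hf (n := gradient f p)
      (v := v) (by rw [← inner_gradient_eq_fderiv, real_inner_self_eq_norm_sq, hn]; norm_num)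
      (by rw [← inner_gradient_eq_fderiv, real_inner_comm]; exact hv)
    refine ⟨γ, hγ.of_le (by norm_num), ?_, hγ0, hγ1⟩
    have h1 := hγ.continuousAt.eventually (by rwa [hγ0])
    filter_upwards [hγf, h1] with t ht1 ht2 using ht2.2 ht1

theorem unitNormals_of_level (hf : ContDiffAt ℝ 2 f p) (hn : ‖gradient f p‖ = 1)
    (hS : ∀ᶠ x in 𝓝 p, x ∈ S ↔ f x = f p) :
    unitNormals S p = {gradient f p, -gradient f p} := by
  set n := gradient f p with hndef
  ext N
  simp only [unitNormals, tangentVectors_of_level hf hn hS, mem_ofPred_eq, mem_insert_iff,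
    mem_singleton_iff, ← hndef]
  constructor
  · rintro ⟨hN, h⟩
    -- The component of `N` orthogonal to `n` is tangent, hence orthogonal to `N`; this says `⟨N,
    -- n⟩² = 1`.
    have h1 := h (N - inner ℝ N n • n) (by
      rw [inner_sub_left, inner_smul_left, real_inner_self_eq_norm_sq, hn]; simp)
    rw [inner_sub_left, inner_smul_left, real_inner_self_eq_norm_sq, hN, real_inner_comm N n] at h1
    have h2 : inner ℝ N n = 1 ∨ inner ℝ N n = -1 := by
      rw [← sq_eq_one_iff]
      simp only [RCLike.conj_to_real] at h1
      linarith
    rcases h2 with h2 | h2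
    · exact Or.inl ((inner_eq_one_iff_of_norm_eq_one (𝕜 := ℝ) hN hn).1 h2)
    · refine Or.inr ((inner_eq_one_iff_of_norm_eq_one (𝕜 := ℝ) hN (by simpa using hn)).1 ?_)
      rw [inner_neg_right, h2, neg_neg]
  · rintro (rfl | rfl)
    · exact ⟨hn, fun v hv => hv⟩
    · exact ⟨by simpa using hn, fun v hv => by simpa using hv⟩

/-- The normal curvatures of a level set of a function with unit gradient, with respect to the
normal `σ ∇f` with `σ = ±1`, are the values of `-σ D²f`. -/
theorem hasNormalCurvature_iff_of_level (hf : ContDiffAt ℝ 2 f p) (hn : ‖gradient f p‖ = 1)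
    (hS : ∀ᶠ x in 𝓝 p, x ∈ S ↔ f x = f p) {σ : ℝ} (hσ : σ ≠ 0) (v : E3) (k : ℝ) :
    HasNormalCurvature S p (σ • gradient f p) v k ↔
      ‖v‖ = 1 ∧ inner ℝ v (gradient f p) = 0 ∧
        k = -σ * inner ℝ (fderiv ℝ (gradient f) p v) v := by
  constructor
  · rintro ⟨hv, γ, hγ, hγS, hγ0, rfl, rfl⟩
    have h1 : ∀ᶠ t in 𝓝 (0 : ℝ), f (γ t) = f p := by
      have h2 := hγ.continuousAt.eventually (by rwa [hγ0])
      filter_upwards [hγS, h2] with t ht1 ht2 using ht2.1 ht1.1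
    refine ⟨hv, ?_, ?_⟩
    · rw [real_inner_comm]
      exact inner_gradient_deriv_of_level (hf.differentiableAt (by norm_num))
        (hγ.differentiableAt (by norm_num)) hγ0 h1
    · rw [inner_smul_right, inner_deriv_deriv_gradient_of_level hf hγ hγ0 h1]
      ring
  · rintro ⟨hv, hvn, rfl⟩
    obtain ⟨γ, hγ, hγ0, rfl, hγf, hspan⟩ := exists_curve_in_normal_section hf
      (n := σ • gradient f p) (v := v)
      (by rw [← inner_gradient_eq_fderiv, inner_smul_right, real_inner_self_eq_norm_sq, hn]
          simpa using hσ)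
      (by rw [← inner_gradient_eq_fderiv, real_inner_comm]; exact hvn)
    refine ⟨hv, γ, hγ, ?_, hγ0, rfl, ?_⟩
    · have h1 := hγ.continuousAt.eventually (by rwa [hγ0])
      filter_upwards [hγf, h1] with t ht1 ht2 using ⟨ht2.2 ht1, hspan t⟩
    · rw [inner_smul_right, inner_deriv_deriv_gradient_of_level hf hγ hγ0 hγf]
      ring

/-- Each unit tangent vector has exactly one normal curvature, so the extremum over curvatures is
one of a quadratic form. -/
theorem mem_minPrincipalDirections_iff_of_level (hf : ContDiffAt ℝ 2 f p)
    (hn : ‖gradient f p‖ = 1) (hS : ∀ᶠ x in 𝓝 p, x ∈ S ↔ f x = f p) {σ : ℝ} (hσ : σ ≠ 0) (v : E3) :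
    v ∈ minPrincipalDirections S p (σ • gradient f p) ↔
      ‖v‖ = 1 ∧ inner ℝ v (gradient f p) = 0 ∧
        ∀ w, ‖w‖ = 1 → inner ℝ w (gradient f p) = 0 →
          -σ * inner ℝ (fderiv ℝ (gradient f) p v) v ≤
            -σ * inner ℝ (fderiv ℝ (gradient f) p w) w := by
  simp only [minPrincipalDirections, mem_ofPred_eq, hasNormalCurvature_iff_of_level hf hn hS hσ]
  constructor
  · rintro ⟨k, ⟨h1, h2, rfl⟩, h⟩
    exact ⟨h1, h2, fun w hw hwn => h w _ ⟨hw, hwn, rfl⟩⟩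
  · rintro ⟨h1, h2, h⟩
    exact ⟨_, ⟨h1, h2, rfl⟩, fun w l hl => hl.2.2 ▸ h w hl.1 hl.2.1⟩

theorem mem_maxPrincipalDirections_iff_of_level (hf : ContDiffAt ℝ 2 f p)
    (hn : ‖gradient f p‖ = 1) (hS : ∀ᶠ x in 𝓝 p, x ∈ S ↔ f x = f p) {σ : ℝ} (hσ : σ ≠ 0) (v : E3) :
    v ∈ maxPrincipalDirections S p (σ • gradient f p) ↔
      ‖v‖ = 1 ∧ inner ℝ v (gradient f p) = 0 ∧
        ∀ w, ‖w‖ = 1 → inner ℝ w (gradient f p) = 0 →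
          -σ * inner ℝ (fderiv ℝ (gradient f) p w) w ≤
            -σ * inner ℝ (fderiv ℝ (gradient f) p v) v := by
  simp only [maxPrincipalDirections, mem_ofPred_eq, hasNormalCurvature_iff_of_level hf hn hS hσ]
  constructor
  · rintro ⟨k, ⟨h1, h2, rfl⟩, h⟩
    exact ⟨h1, h2, fun w hw hwn => h w _ ⟨hw, hwn, rfl⟩⟩
  · rintro ⟨h1, h2, h⟩
    exact ⟨_, ⟨h1, h2, rfl⟩, fun w l hl => hl.2.2 ▸ h w hl.1 hl.2.1⟩

end NormalCurvature

/-! ### The signed distance, its gradient and its Hessian. -/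

section SignedDistance

variable {Ω : Set E3} {ε : ℝ}

/-- Otherwise the interiors of `s` and of its complement would disconnect the segment. -/
theorem exists_mem_segment_frontier {E : Type*} [NormedAddCommGroup E] [NormedSpace ℝ E]
    {s : Set E} {x y : E} (hx : x ∈ s) (hy : y ∉ s) : ∃ w ∈ segment ℝ x y, w ∈ frontier s := by
  have h1 : IsPreconnected (segment ℝ x y) := (convex_segment x y).isPreconnected
  by_contra! h
  have h2 : segment ℝ x y ⊆ interior s ∪ interior sᶜ := by
    intro w hw
    have h3 := h w hw
    rw [frontier, mem_sdiff, not_and_not_right] at h3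
    by_cases h4 : w ∈ closure s
    · exact Or.inl (h3 h4)
    · exact Or.inr (by rwa [interior_compl])
  have h5 : x ∈ interior s := by
    rcases h2 (left_mem_segment ℝ x y) with h | h
    · exact h
    · exact absurd hx (interior_subset h)
  have h6 : y ∈ interior sᶜ := by
    rcases h2 (right_mem_segment ℝ x y) with h | h
    · exact absurd (interior_subset h) hy
    · exact h
  obtain ⟨w, -, hw1, hw2⟩ := h1 _ _ isOpen_interior isOpen_interior h2
    ⟨x, left_mem_segment ℝ x y, h5⟩ ⟨y, right_mem_segment ℝ x y, h6⟩
  exact interior_subset hw2 (interior_subset hw1)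

theorem infDist_frontier_add_le {x y : E3} (hx : x ∈ Ω) (hy : y ∉ Ω) :
    infDist x (frontier Ω) + infDist y (frontier Ω) ≤ dist x y := by
  obtain ⟨w, hw, hwf⟩ := exists_mem_segment_frontier hx hy
  rw [← dist_add_dist_of_mem_segment hw, dist_comm w y]
  exact add_le_add (infDist_le_dist_of_mem hwf) (infDist_le_dist_of_mem hwf)

theorem lipschitzWith_signedDistance : LipschitzWith 1 (signedDistance Ω) := by
  refine LipschitzWith.of_le_add fun x y => ?_
  have hx0 : 0 ≤ infDist x (frontier Ω) := infDist_nonneg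
  have hy0 : 0 ≤ infDist y (frontier Ω) := infDist_nonneg
  unfold signedDistance
  split_ifs with hx hy hy
  · exact infDist_le_infDist_add_dist
  -- For points on opposite sides, the segment crosses the frontier.
  · linarith [infDist_frontier_add_le hx hy]
  · linarith [dist_nonneg (x := x) (y := y)]
  · have h : infDist y (frontier Ω) ≤ infDist x (frontier Ω) + dist y x :=
      infDist_le_infDist_add_dist
    rw [dist_comm] at h
    linarith

theorem abs_signedDistance (x : E3) : |signedDistance Ω x| = infDist x (frontier Ω) := by
  unfold signedDistance
  split_ifs
  · exact abs_of_nonneg infDist_nonneg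
  · rw [abs_neg, abs_of_nonneg infDist_nonneg]

theorem signedDistance_eq_zero_iff (h : (frontier Ω).Nonempty) {x : E3} :
    signedDistance Ω x = 0 ↔ x ∈ frontier Ω := by
  rw [← abs_eq_zero, abs_signedDistance, isClosed_frontier.mem_iff_infDist_zero h]

theorem isOpen_tube : IsOpen (tube Ω ε) :=
  isOpen_lt lipschitzWith_signedDistance.continuous.abs continuous_const

theorem contDiffAt_signedDistance (hd : ContDiffOn ℝ 2 (signedDistance Ω) (tube Ω ε)) {x : E3}
    (hx : x ∈ tube Ω ε) : ContDiffAt ℝ 2 (signedDistance Ω) x :=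
  hd.contDiffAt (isOpen_tube.mem_nhds hx)

theorem norm_sub_closestPoint {x q : E3} (hq : IsClosestPoint (frontier Ω) x q) :
    ‖x - q‖ = |signedDistance Ω x| := by
  rw [abs_signedDistance, ← dist_eq_norm]
  refine le_antisymm ((le_infDist ⟨q, hq.1⟩).2 fun y hy => ?_) (infDist_le_dist_of_mem hq.1)
  simpa [dist_eq_norm] using hq.2 y hy

theorem exists_isClosestPoint (h : (frontier Ω).Nonempty) (x : E3) :
    ∃ q, IsClosestPoint (frontier Ω) x q := by
  obtain ⟨q, hq, hqx⟩ := isClosed_frontier.exists_infDist_eq_dist h x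
  refine ⟨q, hq, fun y hy => ?_⟩
  rw [← dist_eq_norm, ← dist_eq_norm, ← hqx]
  exact infDist_le_dist_of_mem hy

/-- The signed distance is affine on the segment from a point to a closest point. -/
theorem signedDistance_lineMap {x q : E3} (hq : IsClosestPoint (frontier Ω) x q) {s : ℝ}
    (hs : s ∈ Icc (0 : ℝ) 1) :
    signedDistance Ω (q + s • (x - q)) = s * signedDistance Ω x := by
  have hq0 : signedDistance Ω q = 0 := (signedDistance_eq_zero_iff ⟨q, hq.1⟩).2 hq.1
  have hnorm := norm_sub_closestPoint hq
  -- The Lipschitz bounds from `q` and from `x` add up to exactly `|d(x)|`, so both are equalities.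
  have h1 := lipschitzWith_signedDistance (Ω := Ω) |>.dist_le_mul (q + s • (x - q)) q
  have h2 := lipschitzWith_signedDistance (Ω := Ω) |>.dist_le_mul x (q + s • (x - q))
  have h3 : x - (q + s • (x - q)) = (1 - s) • (x - q) := by module
  rw [dist_eq_norm, dist_eq_norm, add_sub_cancel_left, norm_smul, hq0, hnorm, Real.norm_eq_abs,
    Real.norm_of_nonneg hs.1, sub_zero, NNReal.coe_one, one_mul] at h1
  rw [dist_eq_norm, dist_eq_norm, h3, norm_smul, hnorm, Real.norm_eq_abs,
    Real.norm_of_nonneg (sub_nonneg.2 hs.2), NNReal.coe_one, one_mul] at h2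
  have h4 := abs_le.1 h1
  have h5 := abs_le.1 h2
  rcases abs_cases (signedDistance Ω x) with ⟨h6, -⟩ | ⟨h6, -⟩ <;> rw [h6] at h4 h5 <;> linarith

theorem isClosestPoint_lineMap {x q : E3} (hq : IsClosestPoint (frontier Ω) x q) {s : ℝ}
    (hs : s ∈ Icc (0 : ℝ) 1) : IsClosestPoint (frontier Ω) (q + s • (x - q)) q := by
  refine ⟨hq.1, fun y hy => ?_⟩
  have h1 : ‖q + s • (x - q) - q‖ = |signedDistance Ω (q + s • (x - q))| := by
    rw [add_sub_cancel_left, norm_smul, signedDistance_lineMap hq hs, abs_mul,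
      norm_sub_closestPoint hq, Real.norm_eq_abs]
  rw [h1, abs_signedDistance, ← dist_eq_norm]
  exact infDist_le_dist_of_mem hy

theorem lineMap_mem_tube {x q : E3} (hq : IsClosestPoint (frontier Ω) x q) (hx : x ∈ tube Ω ε)
    {s : ℝ} (hs : s ∈ Icc (0 : ℝ) 1) : q + s • (x - q) ∈ tube Ω ε := by
  have h : |signedDistance Ω x| < ε := hx
  rw [tube, mem_ofPred_eq, signedDistance_lineMap hq hs, abs_mul, abs_of_nonneg hs.1]
  exact (mul_le_of_le_one_left (abs_nonneg _) hs.2).trans_lt h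

theorem norm_gradient_signedDistance_le (x : E3) : ‖gradient (signedDistance Ω) x‖ ≤ 1 := by
  rw [gradient, LinearIsometryEquiv.norm_map]
  exact norm_fderiv_le_of_lipschitz ℝ lipschitzWith_signedDistance

/-- Off the boundary, the gradient of the signed distance on the segment from a point to a closest
point is the unit vector along that segment. -/
theorem gradient_signedDistance_lineMap (hd : ContDiffOn ℝ 2 (signedDistance Ω) (tube Ω ε))
    {x q : E3} (hx : x ∈ tube Ω ε) (hx0 : signedDistance Ω x ≠ 0)
    (hq : IsClosestPoint (frontier Ω) x q) {s : ℝ} (hs : s ∈ Icc (0 : ℝ) 1) :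
    gradient (signedDistance Ω) (q + s • (x - q)) = (signedDistance Ω x)⁻¹ • (x - q) := by
  have h1 : HasDerivAt (fun t : ℝ => q + t • (x - q)) (x - q) s := by
    simpa using ((hasDerivAt_id s).smul_const (x - q)).const_add q
  have h2 := ((contDiffAt_signedDistance hd (lineMap_mem_tube hq hx hs)).differentiableAt
    (by norm_num)).hasFDerivAt.comp_hasDerivAt s h1
  have h3 : HasDerivWithinAt (fun t : ℝ => t * signedDistance Ω x) (signedDistance Ω x)
      (Icc 0 1) s := by
    simpa using ((hasDerivAt_id s).mul_const (signedDistance Ω x)).hasDerivWithinAt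
  -- The affine formula holds on `[0, 1]` only; derivatives within this interval also cover the
  -- endpoints, in particular `q` itself.
  have h4 := (uniqueDiffOn_Icc_zero_one s hs).eq_deriv _
    (h2.hasDerivWithinAt.congr (fun t ht => (signedDistance_lineMap hq ht).symm)
      (signedDistance_lineMap hq hs).symm) h3
  rw [← inner_gradient_eq_fderiv] at h4
  set g := gradient (signedDistance Ω) (q + s • (x - q))
  set n := (signedDistance Ω x)⁻¹ • (x - q) with hn
  have hn1 : ‖n‖ = 1 := by
    rw [hn, norm_smul, norm_sub_closestPoint hq, norm_inv, Real.norm_eq_abs,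
      inv_mul_cancel₀ (abs_ne_zero.2 hx0)]
  have hgn : inner ℝ g n = 1 := by
    rw [hn, inner_smul_right, h4, inv_mul_cancel₀ hx0]
  have hg : ‖g‖ ≤ 1 := norm_gradient_signedDistance_le _
  -- `‖g‖ ≤ 1`, `‖n‖ = 1` and `⟨g, n⟩ = 1` force `g = n`.
  have h5 : ‖g - n‖ ^ 2 ≤ 0 := by
    rw [norm_sub_sq_real, hgn, hn1]
    nlinarith [norm_nonneg g]
  rw [← sub_eq_zero, ← norm_eq_zero]
  exact pow_eq_zero_iff two_ne_zero |>.1 (le_antisymm h5 (sq_nonneg _))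

theorem gradient_signedDistance_eq (hd : ContDiffOn ℝ 2 (signedDistance Ω) (tube Ω ε))
    {x q : E3} (hx : x ∈ tube Ω ε) (hx0 : signedDistance Ω x ≠ 0)
    (hq : IsClosestPoint (frontier Ω) x q) :
    gradient (signedDistance Ω) x = (signedDistance Ω x)⁻¹ • (x - q) := by
  simpa using gradient_signedDistance_lineMap hd hx hx0 hq (right_mem_Icc.2 zero_le_one)

theorem gradient_signedDistance_closestPoint
    (hd : ContDiffOn ℝ 2 (signedDistance Ω) (tube Ω ε))
    {x q : E3} (hx : x ∈ tube Ω ε) (hx0 : signedDistance Ω x ≠ 0)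
    (hq : IsClosestPoint (frontier Ω) x q) :
    gradient (signedDistance Ω) q = (signedDistance Ω x)⁻¹ • (x - q) := by
  simpa using gradient_signedDistance_lineMap hd hx hx0 hq (left_mem_Icc.2 zero_le_one)

/-- The eikonal equation. -/
theorem norm_gradient_signedDistance (hΩ : IsOpen Ω) (h : (frontier Ω).Nonempty)
    (hd : ContDiffOn ℝ 2 (signedDistance Ω) (tube Ω ε)) {x : E3} (hx : x ∈ tube Ω ε) :
    ‖gradient (signedDistance Ω) x‖ = 1 := by
  have hoff : ∀ y ∈ tube Ω ε, signedDistance Ω y ≠ 0 → ‖gradient (signedDistance Ω) y‖ = 1 := by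
    intro y hy hy0
    obtain ⟨q, hq⟩ := exists_isClosestPoint h y
    rw [gradient_signedDistance_eq hd hy hy0 hq, norm_smul, norm_sub_closestPoint hq, norm_inv,
      Real.norm_eq_abs, inv_mul_cancel₀ (abs_ne_zero.2 hy0)]
  by_cases hx0 : signedDistance Ω x = 0
  · rw [signedDistance_eq_zero_iff h] at hx0
    -- On the boundary the norm is a limit from inside `Ω`, where `d ≠ 0` because `Ω` is open.
    have h1 : (𝓝[Ω] x).NeBot := mem_closure_iff_nhdsWithin_neBot.1 (frontier_subset_closure hx0)
    have h2 : Filter.Tendsto (fun y => ‖gradient (signedDistance Ω) y‖) (𝓝[Ω] x)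
        (𝓝 ‖gradient (signedDistance Ω) x‖) :=
      (contDiffAt_gradient (contDiffAt_signedDistance hd hx)).continuousAt.norm.tendsto.mono_left
        nhdsWithin_le_nhds
    refine tendsto_nhds_unique h2 (tendsto_const_nhds.congr' ?_)
    filter_upwards [self_mem_nhdsWithin,
      mem_nhdsWithin_of_mem_nhds (isOpen_tube.mem_nhds hx)] with y hyΩ hyT
    refine (hoff y hyT fun h0 => ?_).symm
    rw [signedDistance_eq_zero_iff h, hΩ.frontier_eq] at h0
    exact h0.2 hyΩ
  · exact hoff x hx hx0

theorem fderiv_gradient_signedDistance_gradient (hΩ : IsOpen Ω) (h : (frontier Ω).Nonempty)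
    (hd : ContDiffOn ℝ 2 (signedDistance Ω) (tube Ω ε)) {x : E3} (hx : x ∈ tube Ω ε) :
    fderiv ℝ (gradient (signedDistance Ω)) x (gradient (signedDistance Ω) x) = 0 :=
  fderiv_gradient_gradient_eq_zero (contDiffAt_signedDistance hd hx)
    ((isOpen_tube.eventually_mem hx).mono fun _ hy => norm_gradient_signedDistance hΩ h hd hy)

theorem frontier_subset_tube (hε : 0 < ε) : frontier Ω ⊆ tube Ω ε := fun x hx => by
  rw [tube, mem_ofPred_eq, (signedDistance_eq_zero_iff ⟨x, hx⟩).2 hx]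
  simpa using hε

/-- The Hessians `A` of the signed distance at a point at level `c` and `A₀` at its closest point
on the boundary are related by `A = A₀ - c A A₀`. -/
theorem fderiv_gradient_signedDistance_eq (hΩ : IsOpen Ω)
    (hd : ContDiffOn ℝ 2 (signedDistance Ω) (tube Ω ε)) {x q : E3} (hx : x ∈ tube Ω ε)
    (hx0 : signedDistance Ω x ≠ 0) (hq : IsClosestPoint (frontier Ω) x q) (v : E3) :
    fderiv ℝ (gradient (signedDistance Ω)) x v = fderiv ℝ (gradient (signedDistance Ω)) q v -
      signedDistance Ω x • fderiv ℝ (gradient (signedDistance Ω)) x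
        (fderiv ℝ (gradient (signedDistance Ω)) q v) := by
  have hqT : q ∈ tube Ω ε := by simpa using lineMap_mem_tube hq hx (left_mem_Icc.2 zero_le_one)
  set d := signedDistance Ω
  set G := gradient d
  set A := fderiv ℝ G x
  set A₀ := fderiv ℝ G q
  have hdx : ContDiffAt ℝ 2 d x := contDiffAt_signedDistance hd hx
  have hdq : ContDiffAt ℝ 2 d q := contDiffAt_signedDistance hd hqT
  have hproj : ∀ y r, y ∈ tube Ω ε → d y ≠ 0 → IsClosestPoint (frontier Ω) y r →
      y - d y • G y = r ∧ G r = G y := by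
    intro y r hy hy0 hr
    have h1 : G y = (d y)⁻¹ • (y - r) := gradient_signedDistance_eq hd hy hy0 hr
    have h2 : G r = (d y)⁻¹ • (y - r) := gradient_signedDistance_closestPoint hd hy hy0 hr
    rw [h1, h2, smul_inv_smul₀ hy0]
    exact ⟨sub_sub_cancel y r, rfl⟩
  obtain ⟨hPx, hGq⟩ := hproj x q hx hx0 hq
  have hGP : ∀ᶠ y in 𝓝 x, G (y - d y • G y) = G y := by
    filter_upwards [isOpen_tube.mem_nhds hx, hdx.continuousAt.eventually_ne hx0] with y hy hy0
    obtain ⟨r, hr⟩ := exists_isClosestPoint ⟨q, hq.1⟩ y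
    obtain ⟨h1, h2⟩ := hproj y r hy hy0 hr
    rw [h1, h2]
  have hG : HasFDerivAt G A x :=
    ((contDiffAt_gradient hdx).differentiableAt (by norm_num)).hasFDerivAt
  have hG₀ : HasFDerivAt G A₀ (x - d x • G x) := by
    rw [hPx]
    exact ((contDiffAt_gradient hdq).differentiableAt (by norm_num)).hasFDerivAt
  have hd' : HasFDerivAt d (fderiv ℝ d x) x := (hdx.differentiableAt (by norm_num)).hasFDerivAt
  have hP := (hasFDerivAt_id x).sub (hd'.smul hG)
  have hcomp := (HasFDerivAt.comp (g := G) x hG₀ hP).unique (hG.congr_of_eventuallyEq hGP)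
  -- The derivative of the projection contains a multiple of `G x`, which `A₀` annihilates.
  have hA₀n : A₀ (G x) = 0 := by
    rw [← hGq]
    exact fderiv_gradient_signedDistance_gradient hΩ ⟨q, hq.1⟩ hd hqT
  have hAv : ∀ u, A u = A₀ u - d x • A₀ (A u) := by
    intro u
    have h1 := congrArg (fun L => L u) hcomp
    simpa [hA₀n] using h1.symm
  -- The chain rule gave `A = A₀ - c A₀ A`; symmetry of both operators reverses the product, so that
  -- eigenvectors of `A₀` can be inserted.
  refine ext_inner_right ℝ fun w => ?_
  have hs : ∀ a b, inner ℝ (A a) b = inner ℝ a (A b) := fderiv_gradient_symm hdx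
  have hs₀ : ∀ a b, inner ℝ (A₀ a) b = inner ℝ a (A₀ b) := fderiv_gradient_symm hdq
  rw [hs, hAv w, inner_sub_left, inner_sub_right, inner_smul_left, inner_smul_right, hs, hs₀, hs₀]
  simp

/-- The eigenvalues of the Hessian of the signed distance change from `κ` to `κ / (1 + c κ)`
between the boundary and the level `c`. -/
theorem hessian_signedDistance_eigenvector (hΩ : IsOpen Ω)
    (hd : ContDiffOn ℝ 2 (signedDistance Ω) (tube Ω ε)) {x q : E3} (hx : x ∈ tube Ω ε)
    (hx0 : signedDistance Ω x ≠ 0) (hq : IsClosestPoint (frontier Ω) x q) {e : E3} {κ : ℝ}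
    (he : e ≠ 0) (heκ : fderiv ℝ (gradient (signedDistance Ω)) q e = κ • e) :
    0 < 1 + signedDistance Ω x * κ ∧
      (1 + signedDistance Ω x * κ) • fderiv ℝ (gradient (signedDistance Ω)) x e = κ • e := by
  have key : ∀ y, y ∈ tube Ω ε → signedDistance Ω y ≠ 0 → IsClosestPoint (frontier Ω) y q →
      (1 + signedDistance Ω y * κ) • fderiv ℝ (gradient (signedDistance Ω)) y e = κ • e := by
    intro y hy hy0 hyq
    have h1 := fderiv_gradient_signedDistance_eq hΩ hd hy hy0 hyq e
    rw [heκ, map_smul] at h1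
    rw [add_smul, one_smul, mul_smul, ← eq_sub_iff_add_eq]
    exact h1
  refine ⟨?_, key x hx hx0 hq⟩
  by_contra! hneg
  set c := signedDistance Ω x
  have hcκ : c * κ ≤ -1 := by linarith
  -- If `1 + cκ ≤ 0`, then `1 + scκ = 0` at the parameter `s = -1/(cκ)` of the segment; there `key`
  -- reads `0 = κ e`, which is impossible.
  have hs : -(c * κ)⁻¹ ∈ Icc (0 : ℝ) 1 := by
    rw [← inv_neg]
    exact ⟨inv_nonneg.2 (by linarith), inv_le_one_of_one_le₀ (by linarith)⟩
  have hcκ0 : c * κ ≠ 0 := by linarith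
  have hκ : κ ≠ 0 := right_ne_zero_of_mul hcκ0
  have h1 := key (q + (-(c * κ)⁻¹) • (x - q)) (lineMap_mem_tube hq hx hs)
    (by rw [signedDistance_lineMap hq hs]; exact mul_ne_zero (neg_ne_zero.2 (inv_ne_zero hcκ0)) hx0)
    (isClosestPoint_lineMap hq hs)
  have h2 : 1 + -(c * κ)⁻¹ * c * κ = 0 := by
    rw [mul_assoc, neg_mul, inv_mul_cancel₀ hcκ0]; ring
  rw [signedDistance_lineMap hq hs, h2, zero_smul] at h1
  exact smul_ne_zero hκ he h1.symm

theorem mem_parallelSurface_iff {η : ℝ} {z : E3} (hz : z ∈ tube Ω ε)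
    (hη : signedDistance Ω z = η) :
    ∀ᶠ x in 𝓝 z, x ∈ parallelSurface Ω ε η ↔ signedDistance Ω x = signedDistance Ω z := by
  filter_upwards [isOpen_tube.mem_nhds hz] with x hx
  simp [parallelSurface, hx, hη]

theorem parallelSurface_zero (hε : 0 < ε) (h : (frontier Ω).Nonempty) :
    parallelSurface Ω ε 0 = frontier Ω := by
  ext x
  rw [parallelSurface, mem_sep_iff, signedDistance_eq_zero_iff h]
  exact ⟨And.right, fun hx => ⟨frontier_subset_tube hε hx, hx⟩⟩

end SignedDistance

/-! ### Comparison of the two surfaces. -/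

theorem principalDirections_congr {S S' : Set E3} {p p' : E3}
    (hN : unitNormals S p = unitNormals S' p')
    (h : ∀ N ∈ unitNormals S' p', minPrincipalDirections S p N = minPrincipalDirections S' p' N ∧
      maxPrincipalDirections S p N = maxPrincipalDirections S' p' N) :
    principalDirections S p = principalDirections S' p' := by
  ext v
  simp only [principalDirections, hN, mem_ofPred_eq]
  refine exists_congr fun N => and_congr_right fun hN' => ?_
  rw [(h N hN').1, (h N hN').2]

theorem mainTheorem1 (Ω : Set E3) (hΩ : IsOpen Ω) (hΩb : Bornology.IsBounded Ω)
    (hΓ : IsC2Surface (frontier Ω))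
    (ε : ℝ) (hd : ContDiffOn ℝ 2 (signedDistance Ω) (tube Ω ε))
    (η : ℝ) (z : E3) (hz : z ∈ parallelSurface Ω ε η)
    (zbar : E3) (hzbar : IsClosestPoint (frontier Ω) z zbar) :
    principalDirections (parallelSurface Ω ε η) z = principalDirections (frontier Ω) zbar ∧
    unitNormals (parallelSurface Ω ε η) z = unitNormals (frontier Ω) zbar ∧
    ∀ N ∈ unitNormals (frontier Ω) zbar,
      minPrincipalDirections (parallelSurface Ω ε η) z N
          = minPrincipalDirections (frontier Ω) zbar N ∧
      maxPrincipalDirections (parallelSurface Ω ε η) z N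
          = maxPrincipalDirections (frontier Ω) zbar N := by
  obtain ⟨hzT, hzη⟩ := hz
  have hne : (frontier Ω).Nonempty := ⟨zbar, hzbar.1⟩
  have hε : 0 < ε := (abs_nonneg (signedDistance Ω z)).trans_lt hzT
  rcases eq_or_ne η 0 with rfl | hη
  · have h1 := norm_sub_closestPoint hzbar
    rw [hzη, abs_zero, norm_eq_zero, sub_eq_zero] at h1
    rw [parallelSurface_zero hε hne, h1]
    exact ⟨rfl, rfl, fun N _ => ⟨rfl, rfl⟩⟩
  have hz0 : signedDistance Ω z ≠ 0 := hzη ▸ hη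
  have hbT : zbar ∈ tube Ω ε := frontier_subset_tube hε hzbar.1
  have hdz := contDiffAt_signedDistance hd hzT
  have hdb := contDiffAt_signedDistance hd hbT
  have hnz := norm_gradient_signedDistance hΩ hne hd hzT
  have hnb := norm_gradient_signedDistance hΩ hne hd hbT
  have hSz := mem_parallelSurface_iff hzT hzη
  have hSb : ∀ᶠ x in 𝓝 zbar, x ∈ frontier Ω ↔ signedDistance Ω x = signedDistance Ω zbar :=
    Filter.Eventually.of_forall fun x => by
      rw [(signedDistance_eq_zero_iff hne).2 hzbar.1, signedDistance_eq_zero_iff hne]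
  have hG : gradient (signedDistance Ω) z = gradient (signedDistance Ω) zbar := by
    rw [gradient_signedDistance_eq hd hzT hz0 hzbar,
      gradient_signedDistance_closestPoint hd hzT hz0 hzbar]
  have hker := fderiv_gradient_signedDistance_gradient hΩ hne hd hzT
  rw [hG] at hker
  have hext := fun v (hv : ‖v‖ = 1) (hvn : inner ℝ v (gradient (signedDistance Ω) zbar) = 0) =>
    extremizes_iff_of_eigenvectors_orthogonal
      (fderiv_gradient_symm hdb) (fderiv_gradient_symm hdz)
      (fderiv_gradient_signedDistance_gradient hΩ hne hd hbT) hker (signedDistance Ω z)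
      (fun e κ => hessian_signedDistance_eigenvector hΩ hd hzT hz0 hzbar) hv hvn
  have hN : unitNormals (parallelSurface Ω ε η) z = unitNormals (frontier Ω) zbar := by
    rw [unitNormals_of_level hdz hnz hSz, unitNormals_of_level hdb hnb hSb, hG]
  have hdir : ∀ N ∈ unitNormals (frontier Ω) zbar,
      minPrincipalDirections (parallelSurface Ω ε η) z N
          = minPrincipalDirections (frontier Ω) zbar N ∧
      maxPrincipalDirections (parallelSurface Ω ε η) z N
          = maxPrincipalDirections (frontier Ω) zbar N := by
    intro N hN'
    obtain ⟨σ, hσ, rfl⟩ : ∃ σ : ℝ, (σ = 1 ∨ σ = -1) ∧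
        N = σ • gradient (signedDistance Ω) zbar := by
      rw [unitNormals_of_level hdb hnb hSb] at hN'
      rcases hN' with rfl | rfl
      · exact ⟨1, Or.inl rfl, (one_smul ℝ _).symm⟩
      · exact ⟨-1, Or.inr rfl, (neg_one_smul ℝ _).symm⟩
    have hσ0 : σ ≠ 0 := by rcases hσ with rfl | rfl <;> norm_num
    constructor
    · ext v
      rw [mem_minPrincipalDirections_iff_of_level hdb hnb hSb hσ0, ← hG,
        mem_minPrincipalDirections_iff_of_level hdz hnz hSz hσ0, hG]
      refine and_congr_right fun hv => and_congr_right fun hvn => ?_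
      -- For `σ = 1` the curvature is minus the Hessian form, so minimal curvature means a maximal
      -- form; for `σ = -1` the roles are not exchanged.
      rcases hσ with rfl | rfl
      · simpa using (hext v hv hvn).1
      · simpa using (hext v hv hvn).2
    · ext v
      rw [mem_maxPrincipalDirections_iff_of_level hdb hnb hSb hσ0, ← hG,
        mem_maxPrincipalDirections_iff_of_level hdz hnz hSz hσ0, hG]
      refine and_congr_right fun hv => and_congr_right fun hvn => ?_
      rcases hσ with rfl | rfl
      · simpa using (hext v hv hvn).2
      · simpa using (hext v hv hvn).1
  exact ⟨principalDirections_congr hN hdir, hN, hdir⟩
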